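/- Let $n,s\ge 0$ be integers, let $f_1,\dots,f_s,h\in\mathbb{R}[x_1,\dots,x_n]$, and let $V=\{x\in\mathbb{R}^n : f_1(x)=\dots=f_s(x)=0\}$. For $e\in\mathbb{R}^s$ put $S_e=\{x\in\mathbb{R}^n : |f_i(x)|\le |e_i| \text{ for } 1\le i\le s\}$. For $I\subseteq\{1,\dots,s\}$, $c\in\mathbb{C}^I$ and $A=\{x\in\mathbb{C}^n : f_i(x)=c_i \text{ for } i\in I\}$, let $\operatorname{crit}(h,A^{\mathrm{reg}})$ be the set of all $x\in A$ such that the differentials $\mathrm{d}_xf_i$, $i\in I$, are linearly independent and $\mathrm{d}_xh$ vanishes on $\bigcap_{i\in I}\ker \mathrm{d}_xf_i$ (for $I=\varnothing$: $A=\mathbb{C}^n$ and the condition is $\mathrm{d}_xh=0$). For $e\in\mathbb{C}^s$ let $$Q_e=\bigcup_{I\subseteq\{1,\dots,s\},\ \sigma:I\to\{\pm1\}}\operatorname{crit}\big(h,\{x\in\mathbb{C}^n : f_i(x)=\sigma_ie_i \text{ for } i\in I\}^{\mathrm{reg}}\big)\subseteq\mathbb{C}^n .$$ For $e\in\mathbb{R}^s$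 let $W_e=\bigcup_{r\in\mathbb{C}\setminus\{0\}}Q_{re}$, and let $\overline{W_e}$ be its closure in $\mathbb{C}^n$ for the Euclidean topology. For $e\in\mathbb{R}^s$ let $P_e\subseteq\mathbb{R}^n$ be the union, over all $I\subseteq\{1,\dots,s\}$ and $\sigma:I\to\{\pm1\}$, of the sets of critical points of $h$ on the regular locus of the real stratum $\{x\in\mathbb{R}^n : f_i(x)=\sigma_ie_i \text{ for } i\in I,\ |f_i(x)|<|e_i| \text{ for } i\notin I\}$, where regular and critical points are defined as above, over $\mathbb{R}$. Let $\Sigma_e=h(P_e)\subseteq\mathbb{R}$ and $$\lim_{r\to0}\Sigma_{re}=\bigcap_{R>0}\overline{\bigcup_{0<r<R}\Sigma_{re}},$$ where the bar denotes Euclidean closure in $\mathbb{R}$. Then for every $e\in(\mathbb{R}\setminus\{0\})^s$ the set $h(V\cap\overline{W_e})$ is finite, where $\mathbb{R}^n$ is regarded as a subset of $\mathbb{C}^n$. Moreover, if the restriction $h|_{S_e}:S_e\to\mathbb{R}$ is proper, then $\lim_{r\to0}\Sigma_{re}\subseteq h(V\cap\overline{W_e})$. -/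

import Mathlib

open MvPolynomial Set

noncomputable section

namespace LimitCrit

/-- The gradient of a real polynomial `p` at a point `x` with coordinates in `K` (`K` is `ℝ` or `ℂ`),
that is the coordinate vector of the differential `d_x p`. -/
def grad {K : Type*} [Field K] [Algebra ℝ K] {n : ℕ}
    (p : MvPolynomial (Fin n) ℝ) (x : Fin n → K) : Fin n → K :=
  fun j => aeval x (pderiv j p)

/-- `crit(h, {f_i = c_i for i ∈ I}^reg)` over `K`: the points `x` of the level set `f_i = c_i`, `i ∈ I`,
at which the differentials `d_x f_i`, `i ∈ I`, are linearly independent (regular points),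
and at which `d_x h` vanishes on the tangent space `{v | d_x f_i v = 0 for i ∈ I}`. -/
def regCrit {K : Type*} [Field K] [Algebra ℝ K] {n s : ℕ}
    (f : Fin s → MvPolynomial (Fin n) ℝ) (h : MvPolynomial (Fin n) ℝ)
    (I : Finset (Fin s)) (c : Fin s → K) : Set (Fin n → K) :=
  {x | (∀ i ∈ I, aeval x (f i) = c i) ∧
    LinearIndependent K (fun i : I => grad (f i) x) ∧
    ∀ v : Fin n → K, (∀ i ∈ I, grad (f i) x ⬝ᵥ v = 0) → grad h x ⬝ᵥ v = 0}

/-- The real algebraic set `V = {x ∈ ℝⁿ | f_1 = ⋯ = f_s = 0}`. -/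
def V {n s : ℕ} (f : Fin s → MvPolynomial (Fin n) ℝ) : Set (Fin n → ℝ) :=
  {x | ∀ i, eval x (f i) = 0}

/-- `S_e = {x ∈ ℝⁿ | |f_i(x)| ≤ |e_i| for all i}`. -/
def S {n s : ℕ} (f : Fin s → MvPolynomial (Fin n) ℝ) (e : Fin s → ℝ) : Set (Fin n → ℝ) :=
  {x | ∀ i, |eval x (f i)| ≤ |e i|}

/-- `P_e`: the critical points of `h` on the regular loci of the strata
`{f_i = σ_i e_i for i ∈ I, |f_i| < |e_i| for i ∉ I}` of `S_e`.
Only the values of `σ` on `I` matter. -/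
def P {n s : ℕ} (f : Fin s → MvPolynomial (Fin n) ℝ) (h : MvPolynomial (Fin n) ℝ)
    (e : Fin s → ℝ) : Set (Fin n → ℝ) :=
  ⋃ (I : Finset (Fin s)) (σ : Fin s → ℤˣ),
    {x | x ∈ regCrit f h I (fun i => ((σ i : ℤ) : ℝ) * e i) ∧
      ∀ i ∉ I, |eval x (f i)| < |e i|}

/-- `Σ_e = h(P_e)`: the critical values of `h` on the strata of `S_e`. -/
def critValues {n s : ℕ} (f : Fin s → MvPolynomial (Fin n) ℝ) (h : MvPolynomial (Fin n) ℝ)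
    (e : Fin s → ℝ) : Set ℝ :=
  (fun x => eval x h) '' P f h e

/-- `lim_{r → 0} Σ_{re} = ⋂_{R > 0} closure (⋃_{0 < r < R} Σ_{re})`. -/
def limCritValues {n s : ℕ} (f : Fin s → MvPolynomial (Fin n) ℝ) (h : MvPolynomial (Fin n) ℝ)
    (e : Fin s → ℝ) : Set ℝ :=
  ⋂ (R : ℝ) (_ : 0 < R), closure (⋃ (r : ℝ) (_ : 0 < r ∧ r < R), critValues f h (r • e))

/-- `Q_e ⊆ ℂⁿ`: the union over all `I ⊆ {1, …, s}` and all signs `σ` of the complex critical points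
of `h` on the regular locus of `{f_i = σ_i e_i for i ∈ I}`. -/
def Q {n s : ℕ} (f : Fin s → MvPolynomial (Fin n) ℝ) (h : MvPolynomial (Fin n) ℝ)
    (e : Fin s → ℂ) : Set (Fin n → ℂ) :=
  ⋃ (I : Finset (Fin s)) (σ : Fin s → ℤˣ),
    regCrit f h I (fun i => ((σ i : ℤ) : ℂ) * e i)

/-- `W_e = ⋃_{r ∈ ℂ, r ≠ 0} Q_{re}`. -/
def W {n s : ℕ} (f : Fin s → MvPolynomial (Fin n) ℝ) (h : MvPolynomial (Fin n) ℝ)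
    (e : Fin s → ℝ) : Set (Fin n → ℂ) :=
  ⋃ (r : ℂ) (_ : r ≠ 0), Q f h (fun i => r * (e i : ℂ))

/-- `V ∩ closure W_e`, with `ℝⁿ` embedded in `ℂⁿ` coordinatewise. -/
def VInterClosureW {n s : ℕ} (f : Fin s → MvPolynomial (Fin n) ℝ) (h : MvPolynomial (Fin n) ℝ)
    (e : Fin s → ℝ) : Set (Fin n → ℝ) :=
  V f ∩ {x | (fun j => (x j : ℂ)) ∈ closure (W f h e)}

end LimitCrit

end

/-!
Finiteness. Fix a set `I` of constraints and signs `σ`, and put `c i = σ i * e i`. At a critical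
point `x` of `h` on `{f i = c i * r for i ∈ I}` there are multipliers `l` with
`dh = ∑ i ∈ I, l i • df i`. The triples `(x, l, r)` satisfying these equations form an affine
variety `Y`, on which `dh = ∑ l i • df i = (∑ l i * c i) • dr`. In characteristic zero this makes `r`
and `h` algebraically dependent on each irreducible component of `Y`, since otherwise the function
field of that component would have a derivation killing `r` but not `h`
(`not_algebraicIndependent_of_lagrange`). Hence a single polynomial `G ≠ 0` satisfies
`G (r, h(x)) = 0` on all of `Y` (`exists_relation_of_lagrange`). After division by a power of the
first variable, `G (0, t)` is a nonzero polynomial in `t`, and the relation persists where `r ≠ 0`.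
A point `x` of `V` in the closure is a limit of critical points with `r → 0`: if `I` is nonempty then
`r = f i / c i` for some `i ∈ I`, and if `I` is empty then `r` is arbitrary. So `h(x)` is a root of
`G (0, t)` (`finite_limits_of_relation`, `finite_values_stratum`), and there are finitely many pairs
`(I, σ)`.

Containment. A point of `lim Σ_{re}` is a limit of values `h(x_k)` with `x_k ∈ P_{r_k e}` and
`r_k → 0`. These points lie in `S_e`, so by properness they have a cluster point `y` with the right
value of `h`; it lies in `V` because `|f i (x_k)| ≤ r_k * |e i|`, and in the closure of `W_e` because
real critical points are complex critical points (`regCrit_ofReal`).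
-/

namespace LimitCrit

/-! ### Derivations and algebraic independence -/

open TensorProduct in
/-- Derivations extend along formally étale algebras, because `T ⊗[S] Ω[S⁄k] ≃ Ω[T⁄k]`. -/
theorem exists_derivation_extending {k S T : Type*} [CommRing k] [CommRing S] [CommRing T]
    [Algebra k S] [Algebra k T] [Algebra S T] [IsScalarTower k S T] [Algebra.FormallyEtale S T]
    (d : Derivation k S T) : ∃ D : Derivation k T T, ∀ a, D (algebraMap S T a) = d a := by
  refine ⟨((d.liftKaehlerDifferential.liftBaseChange T) ∘ₗ
    (KaehlerDifferential.tensorKaehlerEquivOfFormallyEtale k S T).symm.toLinearMap).compDer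
      (KaehlerDifferential.D k T), fun a => ?_⟩
  simp [KaehlerDifferential.tensorKaehlerEquivOfFormallyEtale_symm_D_algebraMap]

/-- In characteristic zero, `S → K` is a localization followed by a separable algebraic extension
of fields. -/
theorem formallyEtale_of_isAlgebraic {S K : Type*} [CommRing S] [IsDomain S] [Field K] [CharZero S]
    [Algebra S K] [FaithfulSMul S K] [Algebra.IsAlgebraic S K] : Algebra.FormallyEtale S K := by
  let := FractionRing.liftAlgebra S K
  have := FractionRing.isScalarTower_liftAlgebra S K
  have : CharZero (FractionRing S) :=
    charZero_of_injective_algebraMap (IsFractionRing.injective S (FractionRing S))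
  have : Algebra.IsAlgebraic (FractionRing S) K := 
    Algebra.IsAlgebraic.extendScalars (R := S)
      (IsFractionRing.injective S (FractionRing S))
  have : Algebra.FormallyEtale S (FractionRing S) :=
    Algebra.FormallyEtale.of_isLocalization (nonZeroDivisors S)
  have : Algebra.FormallyEtale (FractionRing S) K :=
    Algebra.FormallyEtale.of_isSeparable (FractionRing S) K
  exact Algebra.FormallyEtale.comp S (FractionRing S) K

/-- In characteristic zero the values of a derivation on algebraically independent elements can be
prescribed: complete them to a transcendence basis `t`, over whose polynomial ring the field is
formally étale. -/
theorem exists_derivation_of_algebraicIndependent {k K ι : Type*} [Field k] [CharZero k] [Field K]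
    [Algebra k K] {x : ι → K} (hx : AlgebraicIndependent k x) (v : ι → K) :
    ∃ D : Derivation k K K, ∀ i, D (x i) = v i := by
  classical
  obtain ⟨t, hst, ht⟩ := exists_isTranscendenceBasis_superset hx.coe_range
  let : Algebra (MvPolynomial t k) K := (aeval (R := k) ((↑) : t → K)).toAlgebra
  have hmap (p : MvPolynomial t k) : algebraMap (MvPolynomial t k) K p = aeval (↑) p := rfl
  have : IsScalarTower k (MvPolynomial t k) K :=
    .of_algebraMap_eq fun a => by rw [hmap, algebraMap_eq, aeval_C]
  have : FaithfulSMul (MvPolynomial t k) K := (faithfulSMul_iff_algebraMap_injective _ _).2 ht.1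
  have : Algebra.IsAlgebraic (MvPolynomial t k) K := ht.isAlgebraic_iff.2 fun i => by
    have := isAlgebraic_algebraMap (R := MvPolynomial t k) (A := K) (X i)
    rwa [hmap, aeval_X] at this
  have := formallyEtale_of_isAlgebraic (S := MvPolynomial t k) (K := K)
  have hinj : Function.Injective x := hx.injective
  obtain ⟨D, hD⟩ := exists_derivation_extending
    (mkDerivation k (fun a : t => Function.extend x v 0 (a : K)))
  refine ⟨D, fun i => ?_⟩
  have h1 := hD (X ⟨x i, hst ⟨i, rfl⟩⟩)
  rw [hmap, aeval_X, mkDerivation_X] at h1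
  rw [h1, hinj.extend_apply]

/-- The chain rule. -/
theorem derivation_aeval {k K σ : Type*} [Field k] [Field K] [Algebra k K] [Fintype σ]
    (D : Derivation k K K) (x : σ → K) (p : MvPolynomial σ k) :
    D (aeval x p) = ∑ j, aeval x (pderiv j p) * D (x j) := by
  classical
  induction p using MvPolynomial.induction_on with
  | C a => simp
  | add p q hp hq => simp [hp, hq, add_mul, Finset.sum_add_distrib]
  | mul_X p i hp =>
    simp [hp, pderiv_X, Pi.single_apply, add_mul, Finset.sum_add_distrib, Finset.mul_sum,
      ite_mul, mul_ite, apply_ite (aeval x)]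
    exact Finset.sum_congr rfl fun _ _ => by ring

/-- If `f i (x) = c i * r` and the gradient of `h` at `x` is the combination of those of the `f i`
with multipliers `l i`, all in a field `K`, then `r` and `h(x)` are algebraically dependent:
every derivation of `K` that kills `r` kills all `f i (x)`, hence also `h(x)`. -/
theorem not_algebraicIndependent_of_lagrange {k K σ ι : Type*} [Field k] [CharZero k] [Field K]
    [Algebra k K] [Fintype σ] (f : ι → MvPolynomial σ k) (h : MvPolynomial σ k) (I : Finset ι)
    (c : ι → k) (x : σ → K) (l : ι → K) (r : K)
    (hf : ∀ i ∈ I, aeval x (f i) = algebraMap k K (c i) * r)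
    (hh : ∀ j, aeval x (pderiv j h) = ∑ i ∈ I, l i * aeval x (pderiv j (f i))) :
    ¬ AlgebraicIndependent k ![r, aeval x h] := by
  intro hind
  obtain ⟨D, hD⟩ := exists_derivation_of_algebraicIndependent hind ![0, 1]
  have hr : D r = 0 := hD 0
  have h1 : D (aeval x h) = 1 := hD 1
  have h0 : D (aeval x h) = ∑ i ∈ I, l i * D (aeval x (f i)) := by
    simp only [derivation_aeval, hh, Finset.sum_mul, Finset.mul_sum]
    rw [Finset.sum_comm]
    exact Finset.sum_congr rfl fun _ _ => Finset.sum_congr rfl fun _ _ => by ring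
  rw [h1, Finset.sum_eq_zero] at h0
  · exact one_ne_zero h0
  · intro i hi
    rw [hf i hi, Derivation.leibniz]
    simp [hr]

/-- A family that is algebraically dependent at every prime satisfies one nontrivial relation up to
nilpotents, namely the product of the relations at the finitely many minimal primes. -/
theorem exists_aeval_mem_nilradical {k A τ : Type*} [Field k] [CommRing A] [IsNoetherianRing A]
    [Algebra k A] (a : τ → A)
    (H : ∀ (p : Ideal A) [p.IsPrime],
      ¬ AlgebraicIndependent k fun i => algebraMap A p.ResidueField (a i)) :
    ∃ G : MvPolynomial τ k, G ≠ 0 ∧ aeval a G ∈ nilradical A := by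
  have hex (p : Ideal A) (hp : p.IsPrime) :
      ∃ G : MvPolynomial τ k, G ≠ 0 ∧ aeval a G ∈ p := by
    have := H p
    rw [algebraicIndependent_iff] at this
    push Not at this
    obtain ⟨G, hG, hG0⟩ := this
    refine ⟨G, hG0, Ideal.algebraMap_residueField_eq_zero.1 ?_⟩
    rw [← hG]
    exact (aeval_algebraMap_apply p.ResidueField a G).symm
  have hfin := minimalPrimes.finite_of_isNoetherianRing A
  choose! G hG0 hG using hex
  refine ⟨∏ p ∈ hfin.toFinset, G p, ?_, ?_⟩
  · exact Finset.prod_ne_zero_iff.2 fun p hp => hG0 p (hfin.mem_toFinset.1 hp).1.1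
  · rw [nilradical, Ideal.zero_eq_bot, ← Ideal.sInf_minimalPrimes, Ideal.mem_sInf]
    intro p hp
    rw [map_prod]
    exact Ideal.mem_of_dvd _ (Finset.dvd_prod_of_mem _ (hfin.mem_toFinset.2 hp))
      (hG p hp.1.1)

/-- One nonzero polynomial relates `r` and `h(x)` at all points `(x, l, r)` of the variety given by
`f i (x) = c i * r` and the multiplier equations. Its coordinate ring is the quotient `R ⧸ J`, and
the points in question are the `k`-algebra maps from it to `K`. -/
theorem exists_relation_of_lagrange {k σ ι : Type*} (K : Type*) [Field k] [CharZero k] [Fintype σ]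
    [Finite ι] [Field K] [Algebra k K] (f : ι → MvPolynomial σ k) (h : MvPolynomial σ k)
    (I : Finset ι) (c : ι → k) :
    ∃ G : MvPolynomial (Fin 2) k, G ≠ 0 ∧ ∀ (x : σ → K) (l : ι → K) (r : K),
      (∀ i ∈ I, aeval x (f i) = algebraMap k K (c i) * r) →
      (∀ j, aeval x (pderiv j h) = ∑ i ∈ I, l i * aeval x (pderiv j (f i))) →
      aeval ![r, aeval x h] G = 0 := by
  let R := MvPolynomial (σ ⊕ ι ⊕ Unit) k
  let X₀ : σ → R := fun j => X (.inl j)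
  let L₀ : ι → R := fun i => X (.inr (.inl i))
  let r₀ : R := X (.inr (.inr ()))
  let E₁ : ι → R := fun i => aeval X₀ (f i) - algebraMap k R (c i) * r₀
  let E₂ : σ → R := fun j => aeval X₀ (pderiv j h) - ∑ i ∈ I, L₀ i * aeval X₀ (pderiv j (f i))
  let J : Ideal R := Ideal.span (E₁ '' I ∪ Set.range E₂)
  let m : R →ₐ[k] R ⧸ J := Ideal.Quotient.mkₐ k J
  have hm₁ (i) (hi : i ∈ I) : m (E₁ i) = 0 :=
    Ideal.Quotient.eq_zero_iff_mem.2 (Ideal.subset_span (.inl ⟨i, hi, rfl⟩))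
  have hm₂ (j) : m (E₂ j) = 0 :=
    Ideal.Quotient.eq_zero_iff_mem.2 (Ideal.subset_span (.inr ⟨j, rfl⟩))
  obtain ⟨G, hG0, hG⟩ := exists_aeval_mem_nilradical (k := k) ![m r₀, m (aeval X₀ h)]
    (fun p _ => by
      let φ : R →ₐ[k] p.ResidueField := (IsScalarTower.toAlgHom k (R ⧸ J) p.ResidueField).comp m
      have hsub (q : MvPolynomial σ k) : φ (aeval X₀ q) = aeval (fun j => φ (X₀ j)) q := by
        rw [← AlgHom.comp_apply, comp_aeval]
      have hφ₁ (i) (hi : i ∈ I) : φ (E₁ i) = 0 := by simp [φ, hm₁ i hi]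
      have hφ₂ (j) : φ (E₂ j) = 0 := by simp [φ, hm₂ j]
      have := not_algebraicIndependent_of_lagrange f h I c (fun j => φ (X₀ j))
        (fun i => φ (L₀ i)) (φ r₀)
        (fun i hi => by
          have := hφ₁ i hi
          rwa [map_sub, map_mul, hsub, AlgHom.commutes, sub_eq_zero] at this)
        (fun j => by
          have := hφ₂ j
          rw [map_sub, map_sum, hsub, sub_eq_zero] at this
          simpa only [map_mul, hsub] using this)
      rw [← hsub] at this
      have hvec : (fun i => algebraMap (R ⧸ J) p.ResidueField (![m r₀, m (aeval X₀ h)] i)) =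
          ![φ r₀, φ (aeval X₀ h)] := by
        ext i
        fin_cases i <;> rfl
      rwa [hvec])
  refine ⟨G, hG0, fun x l r hf hh => ?_⟩
  let ψ : R →ₐ[k] K := aeval (Sum.elim x (Sum.elim l fun _ => r))
  have hψX (j) : ψ (X₀ j) = x j := aeval_X ..
  have hψL (i) : ψ (L₀ i) = l i := aeval_X ..
  have hψr : ψ r₀ = r := aeval_X ..
  have hsub (q : MvPolynomial σ k) : ψ (aeval X₀ q) = aeval x q := by
    rw [← AlgHom.comp_apply, comp_aeval]
    simp only [hψX]
  have hJ : ∀ a ∈ J, ψ a = 0 := by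
    intro a ha
    refine (Ideal.span_le (I := RingHom.ker ψ)).2 ?_ ha
    rintro _ (⟨i, hi, rfl⟩ | ⟨j, rfl⟩)
    · change ψ (E₁ i) = 0
      rw [map_sub, map_mul, hsub, AlgHom.commutes, hf i hi, hψr, sub_self]
    · change ψ (E₂ j) = 0
      rw [map_sub, map_sum, hsub, hh j]
      simp only [map_mul, hsub, hψL, sub_self]
  let χ : R ⧸ J →ₐ[k] K := Ideal.Quotient.liftₐ J ψ hJ
  have hχ (a : R) : χ (m a) = ψ a := Ideal.Quotient.liftₐ_apply ..
  have h0 : χ (aeval ![m r₀, m (aeval X₀ h)] G) = 0 :=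
    ((mem_nilradical.1 hG).map χ).eq_zero
  rw [← AlgHom.comp_apply, comp_aeval] at h0
  convert h0 using 3
  ext i
  fin_cases i
  · simp [hχ, hψr]
  · simp [hχ, hsub]

/-! ### Limits along a plane curve -/

/-- A plane curve `G = 0` has only finitely many limit points on the axis `p.1 = 0` when approached
from outside it, even if `G` vanishes on that axis: divide `G` by the highest power of the first
variable that divides it. -/
theorem finite_limits_of_relation {G : MvPolynomial (Fin 2) ℂ} (hG : G ≠ 0) :
    {t : ℂ | ((0 : ℂ), t) ∈ closure {p : ℂ × ℂ | p.1 ≠ 0 ∧ eval ![p.1, p.2] G = 0}}.Finite := by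
  set g := finSuccEquiv ℂ 1 G with hg
  have hg0 : g ≠ 0 := by simpa [hg] using hG
  obtain ⟨q, hq, hqX⟩ := Polynomial.exists_eq_pow_rootMultiplicity_mul_and_not_dvd g hg0 0
  rw [Polynomial.C_0, sub_zero] at hq hqX
  set N := g.rootMultiplicity 0
  have hq0 : q.coeff 0 ≠ 0 := fun h0 => hqX (Polynomial.X_dvd_iff.2 h0)
  have heval (a t : ℂ) : eval ![a, t] G = a ^ N * eval ![a, t] ((finSuccEquiv ℂ 1).symm q) := by
    have h1 : G = (finSuccEquiv ℂ 1).symm g := by simp [hg]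
    have hX : (finSuccEquiv ℂ 1).symm Polynomial.X = X 0 := by
      rw [AlgEquiv.symm_apply_eq, finSuccEquiv_X_zero]
    rw [h1, hq]
    simp [hX]
  have heval0 (t : ℂ) : eval ![0, t] ((finSuccEquiv ℂ 1).symm q) = eval ![t] (q.coeff 0) := by
    have := eval_eq_eval_mv_eval' ![t] 0 ((finSuccEquiv ℂ 1).symm q)
    rw [AlgEquiv.apply_symm_apply, ← Polynomial.coeff_zero_eq_eval_zero,
      Polynomial.coeff_map] at this
    exact this
  have hfin : {t : ℂ | eval ![t] (q.coeff 0) = 0}.Finite := by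
    set u : Polynomial ℂ := aeval ![Polynomial.X] (q.coeff 0) with hu
    have hut (t : ℂ) : u.eval t = eval ![t] (q.coeff 0) := by
      have hv : (fun i => Polynomial.aeval t ((![Polynomial.X] : Fin 1 → Polynomial ℂ) i)) =
          ![t] := by
        ext i; fin_cases i; simp
      rw [hu, ← Polynomial.coe_aeval_eq_eval, ← AlgHom.comp_apply, comp_aeval, hv]
      rfl
    have hu0 : u ≠ 0 := fun h0 => hq0 <| MvPolynomial.funext fun v => by
      have hv : v = ![v 0] := by ext i; fin_cases i; rfl
      rw [hv, ← hut, h0, Polynomial.eval_zero, map_zero]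
    exact u.rootSet_finite ℂ |>.subset fun t ht => by
      rw [Polynomial.mem_rootSet]
      refine ⟨hu0, ?_⟩
      rw [Polynomial.coe_aeval_eq_eval, hut]
      exact ht
  refine hfin.subset fun t ht => ?_
  have hcl : IsClosed {p : ℂ × ℂ | eval ![p.1, p.2] ((finSuccEquiv ℂ 1).symm q) = 0} := by
    refine isClosed_singleton.preimage (f := fun p : ℂ × ℂ => eval ![p.1, p.2] _)
      ((MvPolynomial.continuous_eval _).comp ?_)
    fun_prop
  have := closure_minimal (fun p hp => by
    have h1 := hp.2
    rw [heval] at h1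
    exact (mul_eq_zero.1 h1).resolve_left (pow_ne_zero _ hp.1)) hcl ht
  rwa [mem_ofPred_eq, heval0] at this

/-! ### Limits of complex critical values -/

/-- Lagrange multipliers: a covector vanishing on a common kernel is a combination. -/
theorem exists_multipliers {K : Type*} [Field K] {n : ℕ} {ι : Type*} {I : Finset ι}
    {g : ι → Fin n → K} {w : Fin n → K}
    (H : ∀ v : Fin n → K, (∀ i ∈ I, g i ⬝ᵥ v = 0) → w ⬝ᵥ v = 0) :
    ∃ l : ι → K, ∀ j, w j = ∑ i ∈ I, l i * g i j := by
  classical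
  have h1 : dotProductEquiv K (Fin n) w ∈
      Submodule.span K (Set.range fun i : I => dotProductEquiv K (Fin n) (g i)) := by
    refine FiniteDimensional.mem_span_of_iInf_ker_le_ker fun v hv => ?_
    simp only [Submodule.mem_iInf, LinearMap.mem_ker] at hv ⊢
    exact H v fun i hi => hv ⟨i, hi⟩
  obtain ⟨a, ha⟩ := (Submodule.mem_span_range_iff_exists_fun K).1 h1
  simp only [← map_smul, ← map_sum] at ha
  have ha := (dotProductEquiv K (Fin n)).injective ha
  refine ⟨fun i => if hi : i ∈ I then a ⟨i, hi⟩ else 0, fun j => ?_⟩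
  rw [← ha, Finset.sum_apply, ← Finset.sum_attach I, Finset.univ_eq_attach]
  exact Finset.sum_congr rfl fun i _ => by simp [i.2]

variable {n s : ℕ} (f : Fin s → MvPolynomial (Fin n) ℝ) (h : MvPolynomial (Fin n) ℝ)

/-- The relation between `r` and the critical values of `h` on `{f i = c i * r for i ∈ I}` is
independent of `r`. -/
theorem exists_relation_regCrit (I : Finset (Fin s)) (c : Fin s → ℝ) :
    ∃ G : MvPolynomial (Fin 2) ℂ, G ≠ 0 ∧ ∀ (r : ℂ),
      ∀ x ∈ regCrit f h I (fun i => (c i : ℂ) * r), eval ![r, aeval x h] G = 0 := by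
  obtain ⟨G, hG0, hG⟩ := exists_relation_of_lagrange ℂ f h I c
  refine ⟨map (algebraMap ℝ ℂ) G, ?_, ?_⟩
  · exact (map_ne_zero_iff _ (map_injective _ (algebraMap ℝ ℂ).injective)).2 hG0
  · rintro r x ⟨hf, -, hh⟩
    obtain ⟨l, hl⟩ := exists_multipliers hh
    rw [eval_map, ← aeval_def]
    exact hG x l r hf hl

theorem continuous_aeval (p : MvPolynomial (Fin n) ℝ) :
    Continuous fun x : Fin n → ℂ => aeval x p := by
  simp only [aeval_def, ← eval_map]
  exact MvPolynomial.continuous_eval _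

theorem aeval_ofReal (x : Fin n → ℝ) (p : MvPolynomial (Fin n) ℝ) :
    aeval (fun j => (x j : ℂ)) p = ((eval x p : ℝ) : ℂ) := by
  have := aeval_algebraMap_apply ℂ x p
  rw [← coe_aeval_eq_eval]
  exact this

/-- Limits at common zeros of the `f i` of critical points on the level sets `f i = c i * r`, with
`r ≠ 0` and one fixed `I`, give finitely many values of `h`. -/
theorem finite_values_stratum (I : Finset (Fin s)) (c : Fin s → ℝ) (hc : ∀ i, c i ≠ 0) :
    ((fun x => aeval x h) '' {x : Fin n → ℂ | (∀ i, aeval x (f i) = 0) ∧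
      x ∈ closure (⋃ (r : ℂ) (_ : r ≠ 0), regCrit f h I fun i => (c i : ℂ) * r)}).Finite := by
  obtain ⟨G, hG0, hG⟩ := exists_relation_regCrit f h I c
  refine (finite_limits_of_relation hG0).subset ?_
  rintro _ ⟨x, ⟨hV, hx⟩, rfl⟩
  rcases I.eq_empty_or_nonempty with rfl | ⟨i₀, hi₀⟩
  -- Without constraints the critical set does not depend on `r`, so `r` may tend to `0` freely.
  · have hr (r : ℂ) : regCrit f h ∅ (fun i => (c i : ℂ) * r) =
        regCrit f h ∅ (fun i => (c i : ℂ) * 1) := by simp [regCrit]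
    have h0 : ((0 : ℂ), x) ∈ closure ({0}ᶜ ×ˢ regCrit f h ∅ (fun i => (c i : ℂ) * 1)) := by
      rw [closure_prod_eq]
      refine ⟨by simp, closure_mono ?_ hx⟩
      exact iUnion₂_subset fun r _ => (hr r).subset
    refine map_mem_closure (f := fun p : ℂ × (Fin n → ℂ) => (p.1, aeval p.2 h))
      (continuous_fst.prodMk ((continuous_aeval h).comp continuous_snd)) h0 ?_
    rintro ⟨r, y⟩ ⟨hr0, hy⟩
    exact ⟨hr0, hG r y ((hr r).symm ▸ hy)⟩
  -- Otherwise `r` is the continuous function `f i₀ / c i₀`, which vanishes at the limit point.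
  · have hci : (c i₀ : ℂ) ≠ 0 := by exact_mod_cast hc i₀
    have := map_mem_closure (f := fun y : Fin n → ℂ => (aeval y (f i₀) / (c i₀ : ℂ), aeval y h))
      (t := {p : ℂ × ℂ | p.1 ≠ 0 ∧ eval ![p.1, p.2] G = 0})
      (((continuous_aeval _).div_const _).prodMk (continuous_aeval h)) hx ?_
    · simpa [hV] using this
    · intro y hy
      obtain ⟨r, hr0, hy⟩ := mem_iUnion₂.1 hy
      have : aeval y (f i₀) / (c i₀ : ℂ) = r := by
        rw [hy.1 i₀ hi₀]; field_simp
      simp only [mem_ofPred_eq, this]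
      exact ⟨hr0, hG r y hy⟩

/-- `W_e` as a finite union over the strata `(I, σ)`, with `r` moved inside the union. -/
theorem W_eq (e : Fin s → ℝ) : W f h e = ⋃ (a : Finset (Fin s) × (Fin s → ℤˣ)),
    ⋃ (r : ℂ) (_ : r ≠ 0), regCrit f h a.1 fun i => ((((a.2 i : ℤ) : ℝ) * e i : ℝ) : ℂ) * r := by
  ext x
  simp only [W, Q, mem_iUnion, Prod.exists, exists_prop]
  have hcomm (σ : Fin s → ℤˣ) (r : ℂ) :
      (fun i => ((((σ i : ℤ) : ℝ) * e i : ℝ) : ℂ) * r) = fun i => ((σ i : ℤ) : ℂ) * (r * e i) := by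
    ext i; push_cast; ring
  simp only [hcomm]
  exact ⟨fun ⟨r, hr, I, σ, hx⟩ => ⟨I, σ, r, hr, hx⟩, fun ⟨I, σ, r, hr, hx⟩ => ⟨r, hr, I, σ, hx⟩⟩

theorem finite_values_VInterClosureW (e : Fin s → ℝ) (he : ∀ i, e i ≠ 0) :
    ((fun x => eval x h) '' VInterClosureW f h e).Finite := by
  have hfin := finite_iUnion fun a : Finset (Fin s) × (Fin s → ℤˣ) =>
    finite_values_stratum f h a.1 (fun i => ((a.2 i : ℤ) : ℝ) * e i)
      (fun i => mul_ne_zero (by simp) (he i))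
  refine Finite.of_finite_image (f := ((↑) : ℝ → ℂ)) (hfin.subset ?_)
    Complex.ofReal_injective.injOn
  rintro _ ⟨_, ⟨x, ⟨hV, hx⟩, rfl⟩, rfl⟩
  rw [mem_ofPred_eq, W_eq, closure_iUnion_of_finite] at hx
  obtain ⟨a, ha⟩ := mem_iUnion.1 hx
  refine mem_iUnion.2 ⟨a, fun j => (x j : ℂ), ⟨fun i => ?_, ha⟩, aeval_ofReal x h⟩
  rw [aeval_ofReal, hV i, Complex.ofReal_zero]

/-! ### Limits of real critical values -/

theorem aeval_real (x : Fin n → ℝ) (p : MvPolynomial (Fin n) ℝ) : aeval x p = eval x p := by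
  rw [← coe_aeval_eq_eval]
  rfl

theorem grad_ofReal (p : MvPolynomial (Fin n) ℝ) (x : Fin n → ℝ) :
    grad p (fun j => (x j : ℂ)) = fun j => ((grad p x j : ℝ) : ℂ) := by
  ext j
  rw [grad, aeval_ofReal, grad, aeval_real]

theorem regCrit_ofReal {I : Finset (Fin s)} {c : Fin s → ℝ} {x : Fin n → ℝ}
    (hx : x ∈ regCrit f h I c) :
    (fun j => (x j : ℂ)) ∈ regCrit f h I fun i => (c i : ℂ) := by
  obtain ⟨hf, hli, hh⟩ := hx
  refine ⟨fun i hi => ?_, ?_, fun v hv => ?_⟩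
  · rw [aeval_ofReal, ← aeval_real, hf i hi]
  · simp only [grad_ofReal]
    exact (linearIndependent_algebraMap_comp_iff (S := ℂ)
      (v := fun i : I => grad (f i) x)).2 hli
  · obtain ⟨l, hl⟩ := exists_multipliers hh
    simp only [grad_ofReal] at hv ⊢
    have : (fun j => ((grad h x j : ℝ) : ℂ)) =
        ∑ i ∈ I, (l i : ℂ) • fun j => ((grad (f i) x j : ℝ) : ℂ) := by
      ext j; simp [hl j]
    rw [this, sum_dotProduct]
    exact Finset.sum_eq_zero fun i hi => by rw [smul_dotProduct, hv i hi, smul_zero]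

theorem ofReal_mem_W_of_mem_P {e : Fin s → ℝ} {r : ℝ} (hr : 0 < r) {x : Fin n → ℝ}
    (hx : x ∈ P f h (r • e)) : (fun j => (x j : ℂ)) ∈ W f h e := by
  simp only [P, mem_iUnion] at hx
  obtain ⟨I, σ, hx, -⟩ := hx
  simp only [W, Q, mem_iUnion]
  refine ⟨r, by exact_mod_cast hr.ne', I, σ, ?_⟩
  convert regCrit_ofReal f h hx using 2
  simp

theorem abs_eval_le_of_mem_P {e : Fin s → ℝ} {x : Fin n → ℝ} (hx : x ∈ P f h e) (i : Fin s) :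
    |eval x (f i)| ≤ |e i| := by
  simp only [P, mem_iUnion] at hx
  obtain ⟨I, σ, hx, hx'⟩ := hx
  by_cases hi : i ∈ I
  · have := hx.1 i hi
    rw [aeval_real] at this
    rw [this]
    rcases Int.units_eq_one_or (σ i) with h1 | h1 <;> simp [h1]
  · exact (hx' i hi).le

open Filter Topology in
/-- Along `r → 0` the critical points lie in `S_e`, where properness provides a cluster point. -/
theorem limCritValues_subset (e : Fin s → ℝ)
    (hp : IsProperMap (fun x : S f e => eval (x : Fin n → ℝ) h)) :
    limCritValues f h e ⊆ (fun x => eval x h) '' VInterClosureW f h e := by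
  intro t ht
  simp only [limCritValues, mem_iInter] at ht
  have hex (k : ℕ) : ∃ x : S f e, (fun j => ((x : Fin n → ℝ) j : ℂ)) ∈ W f h e ∧
      (∀ i, |eval (x : Fin n → ℝ) (f i)| ≤ 1 / (k + 1 : ℝ) * |e i|) ∧
      dist t (eval (x : Fin n → ℝ) h) < 1 / (k + 1 : ℝ) := by
    have hk : (0 : ℝ) < 1 / (k + 1 : ℝ) := by positivity
    obtain ⟨u, hu, hdist⟩ := Metric.mem_closure_iff.1 (ht _ hk) _ hk
    obtain ⟨r, ⟨hr0, hr⟩, x, hx, rfl⟩ := mem_iUnion₂.1 hu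
    have hb (i) : |eval x (f i)| ≤ r * |e i| := by
      simpa [abs_mul, abs_of_pos hr0] using abs_eval_le_of_mem_P f h hx i
    have hk1 : 1 / (k + 1 : ℝ) ≤ 1 := by
      rw [div_le_one (by positivity)]; linarith [k.cast_nonneg (α := ℝ)]
    refine ⟨⟨x, fun i => (hb i).trans ?_⟩, ofReal_mem_W_of_mem_P f h hr0 hx, fun i =>
      (hb i).trans (by gcongr), hdist⟩
    exact mul_le_of_le_one_left (abs_nonneg _) (hr.le.trans hk1)
  choose x hxW hxb hxt using hex
  have hlim := tendsto_one_div_add_atTop_nhds_zero_nat (𝕜 := ℝ)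
  have htend : Tendsto (fun k => eval (x k : Fin n → ℝ) h) atTop (𝓝 t) := by
    rw [tendsto_iff_dist_tendsto_zero]
    refine squeeze_zero (fun _ => dist_nonneg) (fun k => ?_) hlim
    rw [dist_comm]
    exact (hxt k).le
  obtain ⟨y, hy, hcl⟩ := hp.clusterPt_of_mapClusterPt (ℱ := map x atTop)
    (y := t) (by simpa [MapClusterPt, map_map, Function.comp_def] using htend.mapClusterPt)
  -- Closed conditions that hold eventually along `x` pass to the cluster point `y`.
  have hmem {C : Set (S f e)} (hC : IsClosed C) (hx : ∀ᶠ k in atTop, x k ∈ C) : y ∈ C :=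
    hC.closure_eq ▸ mem_closure_iff_clusterPt.2 (hcl.mono (le_principal_iff.2 hx))
  refine ⟨y, ⟨fun i => ?_, ?_⟩, hy⟩
  · have hle (k : ℕ) : |eval (y : Fin n → ℝ) (f i)| ≤ 1 / (k + 1 : ℝ) * |e i| := by
      refine hmem (C := {z | |eval (z : Fin n → ℝ) (f i)| ≤ 1 / (k + 1 : ℝ) * |e i|})
        (isClosed_le ((MvPolynomial.continuous_eval _).comp continuous_subtype_val).abs
          continuous_const) ?_
      filter_upwards [eventually_ge_atTop k] with l hl
      refine (hxb l i).trans ?_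
      gcongr
    have := ge_of_tendsto' (hlim.mul_const |e i|) hle
    rw [zero_mul] at this
    exact abs_nonpos_iff.1 this
  · refine hmem (C := {z | (fun j => ((z : Fin n → ℝ) j : ℂ)) ∈ closure (W f h e)})
      (isClosed_closure.preimage ?_) (.of_forall fun k => subset_closure (hxW k))
    exact continuous_pi fun j =>
      Complex.continuous_ofReal.comp ((continuous_apply j).comp continuous_subtype_val)

end LimitCrit

theorem mainTheorem8 {n s : ℕ} (f : Fin s → MvPolynomial (Fin n) ℝ)
    (h : MvPolynomial (Fin n) ℝ) (e : Fin s → ℝ) (he : ∀ i, e i ≠ 0) :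
    ((fun x => MvPolynomial.eval x h) '' LimitCrit.VInterClosureW f h e).Finite ∧
    (IsProperMap (fun x : LimitCrit.S f e => MvPolynomial.eval (x : Fin n → ℝ) h) →
      LimitCrit.limCritValues f h e ⊆
        (fun x => MvPolynomial.eval x h) '' LimitCrit.VInterClosureW f h e) :=
  ⟨LimitCrit.finite_values_VInterClosureW f h e he, LimitCrit.limCritValues_subset f h e⟩
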